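/- **Setting.** Let $\mathcal W\subseteq\mathbb R^d$ be nonempty, closed and convex with $\|x-y\|\le D$ for all $x,y\in\mathcal W$ ($D>0$), and let $T\ge 1$. In round $t=1,\dots,T$ the learner plays $w_t\in\mathcal W$ and then sees a loss $f_t$ that is convex on $\mathcal W$ and has at every $w\in\mathcal W$ a gradient $\nabla f_t(w)$ (relative to $\mathcal W$) with $\|\nabla f_t(w)\|\le G$ ($G>0$). $\Pi_{\mathcal W}$ denotes the Euclidean projection onto $\mathcal W$. **DNP-cu$(\rho,Z)$.** (Discounted-Normal-Predictor with conservative updating.) Let $n=1/(1-\rho)$, $\tilde g(x)=\sqrt{n/8}\,Z\,\mathrm{erf}\big(x/\sqrt{8n}\big)e^{x^2/(16n)}$ with $\mathrm{erf}(x)=\int_0^x e^{-s^2/2}\,ds$, let $g(x)$ be the projection of $\tilde g(x)$ onto $[0,1]$, and $U=\tilde g^{-1}(1)$. Start with $x_1=0$. In round $t$ predict $g(x_t)$ and receive $b_t$; put $x_{t+1}=\rho x_t+b_t$ if $0\le x_t\le U$, or $x_t<0$ and $b_t>0$, or $x_t>U$ and $b_t<0$; otherwise put $x_{t+1}=\rho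 x_t$. **Combiner$(\rho,Z)$** of two algorithms with decisions $p_t$ and $q_t$: it plays $(1-\omega_t)p_t+\omega_t q_t$, where $\omega_t$ is the prediction in round $t$ of DNP-cu$(\rho,Z)$ run on the bits $\ell_t=(f_t(p_t)-f_t(q_t))/(GD)$. **Smoothed OGD$(N,Z)$.** For $i=1,\dots,N+1$ put $\lambda_i=1-2^{i-1}/T$ and $\eta_i=\frac DG\sqrt{2^i/T}$. The expert $\mathcal A_i$ is online gradient descent $w_{t+1,i}=\Pi_{\mathcal W}[w_{t,i}-\eta_i\nabla f_t(w_{t,i})]$ from an arbitrary $w_{1,i}\in\mathcal W$. $\mathcal B_0$ is an arbitrary baseline with decisions in $\mathcal W$, and $\mathcal B_i$ is the Combiner$(\lambda_i,Z)$ of $\mathcal B_{i-1}$ and $\mathcal A_i$. The output $w_t$ is the decision of $\mathcal B_{N+1}$ in round $t$. **Theorem.** Let $Z=1/T$, $\tau\ge\max\{16e,\,32\log\frac1Z\}$ and $N=\lceil\log_2\frac T\tau\rceil$ (read as $0$ if $T<\tau$, when the interval of $\lambda$ below is empty). Then Smoothed OGD$(N,Z)$, which does not depend on $\lambda$, plays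 $w_t\in\mathcal W$ in all rounds $t=1,\dots,T$, and simultaneously for all $\lambda\in[1-\frac1\tau,\,1-\frac1T]$ and all $w\in\mathcal W$, $$\sum_{t=1}^T\lambda^{T-t}f_t(w_t)-\sum_{t=1}^T\lambda^{T-t}f_t(w)\;\le\;\frac{2GD}{\sqrt{1-\lambda}}\Big(4\sqrt{\log\tfrac1Z}+\sqrt2\Big)+\frac{GD(N+1)Z}{1-\lambda}+2GD .$$ Moreover the right-hand side is at most $C\,GD\sqrt{\log T/(1-\lambda)}$, where $C>0$ is an absolute constant. -/

import Mathlib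

namespace SmoothedOGD

noncomputable section

/-! Rounds are numbered `t = 0, …, T - 1`: the round with index `t` is the `(t + 1)`-st round of the
game.  A sequence `w : ℕ → E` of decisions gives the decision `w t` played in that round, and
`f t` is the loss function revealed after it. -/

/-! ### Discounted-Normal-Predictor with conservative updating -/

/-- The error function with the normalisation `erf x = ∫₀ˣ exp (-s² / 2) ds`. -/
def erf (x : ℝ) : ℝ := ∫ s in (0 : ℝ)..x, Real.exp (-s ^ 2 / 2)

/-- The confidence function before projection. -/
def gTilde (n Z x : ℝ) : ℝ :=
  √(n / 8) * Z * erf (x / √(8 * n)) * Real.exp (x ^ 2 / (16 * n))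

/-- The confidence function: the projection of `gTilde` onto `[0, 1]`. -/
def confidence (n Z x : ℝ) : ℝ := max 0 (min 1 (gTilde n Z x))

/-- The threshold `U(n) = gTilde⁻¹(1)` (for `n, Z > 0`, `gTilde n Z` is a bijection of `ℝ`). -/
def threshold (n Z : ℝ) : ℝ := Function.invFun (gTilde n Z) 1

/-- The window length `n = 1 / (1 - ρ)` that belongs to the discount factor `ρ`. -/
def window (ρ : ℝ) : ℝ := 1 / (1 - ρ)

/-- One conservative update of the deviation `x` after the bit `b` has been received. -/
def dnpUpdate (ρ Z x b : ℝ) : ℝ :=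
  if (0 ≤ x ∧ x ≤ threshold (window ρ) Z) ∨ (x < 0 ∧ 0 < b) ∨
      (threshold (window ρ) Z < x ∧ b < 0) then
    ρ * x + b
  else
    ρ * x

/-- The deviation at the beginning of round `t`, when the bits are `b 0, b 1, …`. -/
def dnpState (ρ Z : ℝ) (b : ℕ → ℝ) : ℕ → ℝ
  | 0 => 0
  | t + 1 => dnpUpdate ρ Z (dnpState ρ Z b t) (b t)

/-- The prediction of the predictor in round `t`; it depends only on `b 0, …, b (t - 1)`. -/
def dnpPredict (ρ Z : ℝ) (b : ℕ → ℝ) (t : ℕ) : ℝ :=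
  confidence (window ρ) Z (dnpState ρ Z b t)

variable {E : Type*} [NormedAddCommGroup E] [InnerProductSpace ℝ E]

/-! ### Online gradient descent -/

/-- The projection of `x` onto `W`: a point of `W` nearest to `x` (it exists and is unique when
`W` is nonempty, closed and convex in a Euclidean space). -/
def proj (W : Set E) (x : E) : E :=
  Classical.epsilon fun p => p ∈ W ∧ ∀ q ∈ W, ‖x - p‖ ≤ ‖x - q‖

/-- Online gradient descent over `W` with constant step size `η`, first decision `w₁` and
gradients `grad t`. -/
def ogd (W : Set E) (grad : ℕ → E → E) (η : ℝ) (w₁ : E) : ℕ → E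
  | 0 => w₁
  | t + 1 => proj W (ogd W grad η w₁ t - η • grad t (ogd W grad η w₁ t))

/-! ### Combiner -/

/-- The bit sent to the predictor in round `t`: the scaled difference between the losses of the
two algorithms, whose decisions are `p` and `q`. -/
def combinerBit (G D : ℝ) (f : ℕ → E → ℝ) (p q : ℕ → E) (t : ℕ) : ℝ :=
  (f t (p t) - f t (q t)) / (G * D)

/-- The weight that the Combiner puts on the second algorithm in round `t`. -/
def combinerWeight (G D : ℝ) (f : ℕ → E → ℝ) (ρ Z : ℝ) (p q : ℕ → E) (t : ℕ) : ℝ :=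
  dnpPredict ρ Z (combinerBit G D f p q) t

/-- The decisions of the Combiner with parameters `ρ`, `Z` of two algorithms with decisions `p`
and `q`. -/
def combiner (G D : ℝ) (f : ℕ → E → ℝ) (ρ Z : ℝ) (p q : ℕ → E) (t : ℕ) : E :=
  (1 - combinerWeight G D f ρ Z p q t) • p t + combinerWeight G D f ρ Z p q t • q t

/-! ### Smoothed OGD -/

/-- The discount factor `λ_i = 1 - 2 ^ (i - 1) / T`, for `i ≥ 1`. -/
def discount (T : ℕ) (i : ℕ) : ℝ := 1 - 2 ^ (i - 1) / T

/-- The step size `η_i = (D / G) √(2 ^ i / T)`. -/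
def stepSize (G D : ℝ) (T : ℕ) (i : ℕ) : ℝ := D / G * √(2 ^ i / T)

/-- The decisions of the `i`-th expert, online gradient descent with step size `η_i` started at
`start i`. -/
def expert (W : Set E) (G D : ℝ) (grad : ℕ → E → E) (T : ℕ) (start : ℕ → E) (i : ℕ) : ℕ → E :=
  ogd W grad (stepSize G D T i) (start i)

/-- The decisions of the `i`-th aggregate: the first one is the baseline, and the `(i + 1)`-st
combines the `i`-th with the `(i + 1)`-st expert, with parameters `λ_{i+1}` and `Z`. -/
def aggregate (W : Set E) (G D : ℝ) (f : ℕ → E → ℝ) (grad : ℕ → E → E) (T : ℕ) (Z : ℝ)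
    (base : ℕ → E) (start : ℕ → E) : ℕ → ℕ → E
  | 0 => base
  | i + 1 => combiner G D f (discount T (i + 1)) Z
      (aggregate W G D f grad T Z base start i) (expert W G D grad T start (i + 1))

/-- The decisions of Smoothed OGD with parameters `N` and `Z`: those of the `(N + 1)`-st
aggregate. -/
def sogd (W : Set E) (G D : ℝ) (f : ℕ → E → ℝ) (grad : ℕ → E → E) (T N : ℕ) (Z : ℝ)
    (base : ℕ → E) (start : ℕ → E) : ℕ → E :=
  aggregate W G D f grad T Z base start (N + 1)

/-- The `lam`-discounted cumulative loss of the decisions `w` over `T` rounds; in the numbering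
`t = 1, …, T` the weight of round `t` is `lam ^ (T - t)`. -/
def discountedLoss (f : ℕ → E → ℝ) (T : ℕ) (lam : ℝ) (w : ℕ → E) : ℝ :=
  ∑ t ∈ Finset.range T, lam ^ (T - 1 - t) * f t (w t)

end

end SmoothedOGD

/-! ### Calculus of the confidence function. -/

namespace SmoothedOGD

open Real Set

/-! Everything rests on a potential argument for one predictor. The confidence function g solves g'
= x g / (8n) + Z / 8. For its primitive Φ, a second-order expansion of Φ(ρx + b) has quadratic cost
at most 4 g'(x) = x g / (2n) + Z / 2. The discount contributes the drift -x g / n, which pays for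
this cost and leaves -x g / (2n) ≤ -Φ / n, by convexity of g on x ≥ 0. Hence Φ(ρx + b) ≤ ρ Φ(x) + b
g(x) + Z (`gTildeInt_step`). Clipping g and updating conservatively preserve this inequality and
keep the state below U + 1 (`dnpUpdate_step`, `dnpState_le`).

Summing with any discount λ ≥ ρ, the predictor loses at most Z / (1 - λ) against the constant 0 and
about U (1 - ρ) / (1 - λ) against the constant 1. By convexity of the losses, a Combiner is
therefore almost free relative to its first algorithm and moderately expensive relative to its
second.

Given λ, choose the dyadic level with 1 - λ ≤ 2^k / T ≤ 2 (1 - λ). Its expert has a nearly optimal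
step size, its Combiner pays the expensive regret once with a ratio (1 - ρ) / (1 - λ) of at most 2,
and all later Combiners have ρ ≤ λ and cost only G D Z / (1 - λ) each. Earlier levels do not matter,
since only the membership of their output in W is used. -/

lemma le_of_hasDerivAt_mul_nonneg {φ φ' : ℝ → ℝ} (hd : ∀ t, HasDerivAt φ (φ' t) t) {x y : ℝ}
    (h : ∀ t ∈ uIcc x y, 0 ≤ φ' t * (t - x)) : φ x ≤ φ y := by
  have hc : Continuous φ := continuous_iff_continuousAt.2 fun t => (hd t).continuousAt
  rcases lt_trichotomy x y with hxy | rfl | hxy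
  · obtain ⟨c, hc1, hc2⟩ := exists_hasDerivAt_eq_slope φ φ' hxy hc.continuousOn fun t _ => hd t
    have h1 := h c (by rw [uIcc_of_le hxy.le]; exact ⟨hc1.1.le, hc1.2.le⟩)
    have h2 : 0 ≤ φ' c := nonneg_of_mul_nonneg_left h1 (by linarith [hc1.1])
    rw [hc2, div_nonneg_iff] at h2
    rcases h2 with h2 | h2 <;> linarith [h2.1, h2.2]
  · rfl
  · obtain ⟨c, hc1, hc2⟩ := exists_hasDerivAt_eq_slope φ φ' hxy hc.continuousOn fun t _ => hd t
    have h1 := h c (by rw [uIcc_of_ge hxy.le]; exact ⟨hc1.1.le, hc1.2.le⟩)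
    have h2 : φ' c ≤ 0 := by
      by_contra hcon
      nlinarith [hc1.2]
    rw [hc2, div_le_iff₀ (by linarith)] at h2
    linarith

/-! ### The error function -/

lemma hasDerivAt_erf (x : ℝ) : HasDerivAt erf (exp (-x ^ 2 / 2)) x :=
  ((by fun_prop : Continuous fun s : ℝ => exp (-s ^ 2 / 2)).integral_hasStrictDerivAt
    0 x).hasDerivAt

@[simp] lemma erf_zero : erf 0 = 0 := by simp [erf]

lemma strictMono_erf : StrictMono erf :=
  strictMono_of_deriv_pos fun x => by rw [(hasDerivAt_erf x).deriv]; exact exp_pos _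

lemma erf_neg (x : ℝ) : erf (-x) = -erf x := by
  have h := intervalIntegral.integral_comp_neg (a := 0) (b := x)
    fun s : ℝ => exp (-s ^ 2 / 2)
  simp only [neg_sq, neg_zero] at h
  rw [erf, erf, h, intervalIntegral.integral_symm]

lemma exp_neg_half_le_erf_one : exp (-(1 / 2)) ≤ erf 1 := by
  have h := le_of_hasDerivAt_mul_nonneg (φ := fun x => erf x - exp (-(1 / 2)) * x)
    (φ' := fun x => exp (-x ^ 2 / 2) - exp (-(1 / 2)) * 1) (x := 0) (y := 1)
    (fun t => (hasDerivAt_erf t).sub ((hasDerivAt_id t).const_mul _)) fun t ht => by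
      rw [uIcc_of_le zero_le_one] at ht
      refine mul_nonneg ?_ (by linarith [ht.1])
      have : exp (-(1 / 2)) ≤ exp (-t ^ 2 / 2) := exp_le_exp.2 (by nlinarith [ht.1, ht.2])
      linarith
  simp only [erf_zero] at h
  linarith

/-! ### The confidence function -/

section Confidence

variable {n Z : ℝ}

/-- The derivative of `gTilde n Z`. -/
noncomputable def gTildeSlope (n Z x : ℝ) : ℝ := x * gTilde n Z x / (8 * n) + Z / 8

/-- The primitive of `gTilde n Z` that vanishes at the origin. -/
noncomputable def gTildeInt (n Z x : ℝ) : ℝ := ∫ s in (0 : ℝ)..x, gTilde n Z s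

/-- The factor exp (x² / (16n)) cancels the Gaussian density produced by differentiating erf (x /
√(8n)), so a constant Z / 8 remains next to the linear term. -/
lemma hasDerivAt_gTilde (hn : 0 < n) (x : ℝ) :
    HasDerivAt (gTilde n Z) (gTildeSlope n Z x) x := by
  have h8 : 0 < √(8 * n) := sqrt_pos.2 (by linarith)
  have hs : √(8 * n) ^ 2 = 8 * n := sq_sqrt (by linarith)
  have hq : √(n / 8) = √(8 * n) / 8 := by
    rw [show n / 8 = 8 * n / 8 ^ 2 by ring, sqrt_div (by linarith), sqrt_sq (by norm_num)]
  have h1 : HasDerivAt (fun y => erf (y / √(8 * n)))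
      (exp (-(x / √(8 * n)) ^ 2 / 2) * (1 / √(8 * n))) x :=
    (hasDerivAt_erf _).comp x ((hasDerivAt_id x).div_const _)
  have h2 : HasDerivAt (fun y => exp (y ^ 2 / (16 * n)))
      (exp (x ^ 2 / (16 * n)) * (2 * x / (16 * n))) x := by
    have := ((hasDerivAt_pow 2 x).div_const (16 * n)).exp
    simpa using this
  have h := ((h1.const_mul (√(n / 8) * Z)).mul h2)
  refine h.congr_deriv ?_
  have he : exp (-(x / √(8 * n)) ^ 2 / 2) * exp (x ^ 2 / (16 * n)) = 1 := by
    rw [← exp_add, div_pow, hs, exp_eq_one_iff]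
    field_simp
    ring
  rw [gTildeSlope, gTilde, hq]
  generalize exp (-(x / √(8 * n)) ^ 2 / 2) = A at *
  generalize exp (x ^ 2 / (16 * n)) = B at *
  have : √(8 * n) / 8 * Z * (A * (1 / √(8 * n))) * B = Z / 8 * (A * B) := by field_simp
  rw [this, he]
  field_simp
  ring

@[simp] lemma gTilde_zero : gTilde n Z 0 = 0 := by simp [gTilde]

lemma gTilde_neg (x : ℝ) : gTilde n Z (-x) = -gTilde n Z x := by
  simp [gTilde, neg_div, erf_neg]

lemma gTilde_nonneg (hZ : 0 < Z) {x : ℝ} (hx : 0 ≤ x) : 0 ≤ gTilde n Z x := by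
  have : 0 ≤ erf (x / √(8 * n)) := by
    rw [← erf_zero]; exact strictMono_erf.monotone (by positivity)
  unfold gTilde; positivity

lemma gTilde_mul_self_nonneg (hZ : 0 < Z) (x : ℝ) : 0 ≤ x * gTilde n Z x := by
  rcases le_total 0 x with hx | hx
  · exact mul_nonneg hx (gTilde_nonneg hZ hx)
  · have := gTilde_nonneg (n := n) hZ (neg_nonneg.2 hx)
    rw [gTilde_neg] at this
    nlinarith

lemma gTildeSlope_pos (hn : 0 < n) (hZ : 0 < Z) (x : ℝ) : 0 < gTildeSlope n Z x := by
  have := gTilde_mul_self_nonneg (n := n) hZ x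
  unfold gTildeSlope; positivity

lemma gTildeSlope_neg (x : ℝ) : gTildeSlope n Z (-x) = gTildeSlope n Z x := by
  simp [gTildeSlope, gTilde_neg]

lemma strictMono_gTilde (hn : 0 < n) (hZ : 0 < Z) : StrictMono (gTilde n Z) :=
  strictMono_of_deriv_pos fun x => by
    rw [(hasDerivAt_gTilde hn x).deriv]; exact gTildeSlope_pos hn hZ x

lemma continuous_gTilde (hn : 0 < n) : Continuous (gTilde n Z) :=
  continuous_iff_continuousAt.2 fun t => (hasDerivAt_gTilde hn t).continuousAt

lemma hasDerivAt_gTildeSlope (hn : 0 < n) (x : ℝ) :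
    HasDerivAt (gTildeSlope n Z) ((gTilde n Z x + x * gTildeSlope n Z x) / (8 * n)) x := by
  have h := (((hasDerivAt_id x).mul (hasDerivAt_gTilde (Z := Z) hn x)).div_const (8 * n)).add_const
    (Z / 8)
  refine h.congr_deriv ?_
  simp

/-- The slope is even and increases on the positive half-line. -/
lemma gTildeSlope_le_gTildeSlope (hn : 0 < n) (hZ : 0 < Z) {x y : ℝ} (h : |x| ≤ y) :
    gTildeSlope n Z x ≤ gTildeSlope n Z y := by
  have key : gTildeSlope n Z |x| ≤ gTildeSlope n Z y :=
    le_of_hasDerivAt_mul_nonneg (hasDerivAt_gTildeSlope hn) fun t ht => by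
      rw [uIcc_of_le h] at ht
      have h0 : 0 ≤ t := (abs_nonneg x).trans ht.1
      have h1 := gTilde_nonneg (n := n) hZ h0
      have h2 := gTildeSlope_pos hn hZ t
      have h3 : 0 ≤ t - |x| := by linarith [ht.1]
      positivity
  rcases abs_choice x with hx | hx <;> rw [hx] at key
  · exact key
  · rwa [gTildeSlope_neg] at key

/-- By convexity on the positive half-line, the tangent at x lies below the graph at the origin,
where `gTilde` vanishes. -/
lemma gTilde_le_mul_gTildeSlope (hn : 0 < n) (hZ : 0 < Z) {x : ℝ} (hx : 0 ≤ x) :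
    gTilde n Z x ≤ x * gTildeSlope n Z x := by
  have h := le_of_hasDerivAt_mul_nonneg (φ := fun x => x * gTildeSlope n Z x - gTilde n Z x)
    (fun t => ((hasDerivAt_id t).mul (hasDerivAt_gTildeSlope hn t)).sub (hasDerivAt_gTilde hn t))
    (x := 0) (y := x) fun t ht => by
      rw [uIcc_of_le hx] at ht
      have h0 : 0 ≤ t := ht.1
      have h1 := gTilde_nonneg (n := n) hZ h0
      have h2 := gTildeSlope_pos hn hZ t
      simp only [id, one_mul, add_sub_cancel_left, sub_zero]
      positivity
  simp only [gTilde_zero, zero_mul, sub_zero] at h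
  linarith

/-! ### The primitive of the confidence function and its one-step inequality. -/

lemma hasDerivAt_gTildeInt (hn : 0 < n) (x : ℝ) :
    HasDerivAt (gTildeInt n Z) (gTilde n Z x) x :=
  ((continuous_gTilde hn).integral_hasStrictDerivAt 0 x).hasDerivAt

@[simp] lemma gTildeInt_zero : gTildeInt n Z 0 = 0 := by simp [gTildeInt]

/-- The trapezoid bound for a convex function vanishing at 0; it turns half of the drift into a
discount of the potential. -/
lemma gTildeInt_le_mul_gTilde_div_two (hn : 0 < n) (hZ : 0 < Z) {x : ℝ} (hx : 0 ≤ x) :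
    gTildeInt n Z x ≤ x * gTilde n Z x / 2 := by
  have h := le_of_hasDerivAt_mul_nonneg (φ := fun x => x * gTilde n Z x / 2 - gTildeInt n Z x)
    (fun t => (((hasDerivAt_id t).mul (hasDerivAt_gTilde hn t)).div_const 2).sub
      (hasDerivAt_gTildeInt hn t))
    (x := 0) (y := x) fun t ht => by
      rw [uIcc_of_le hx] at ht
      have h1 := gTilde_le_mul_gTildeSlope hn hZ ht.1
      refine mul_nonneg ?_ (by linarith [ht.1])
      simp only [id, one_mul]
      linarith
  simp only [gTilde_zero, zero_mul, gTildeInt_zero] at h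
  linarith

lemma gTildeInt_add_mul_le (hn : 0 < n) (hZ : 0 < Z) (x y : ℝ) :
    gTildeInt n Z x + gTilde n Z x * (y - x) ≤ gTildeInt n Z y := by
  have h := le_of_hasDerivAt_mul_nonneg
    (φ := fun y => gTildeInt n Z y - gTilde n Z x * (y - x))
    (fun t => (hasDerivAt_gTildeInt hn t).sub (((hasDerivAt_id t).sub_const x).const_mul _))
    (x := x) (y := y) fun t _ => by
      simp only [mul_one]
      have hm := (strictMono_gTilde hn hZ).monotone
      rcases le_total x t with h | h
      · exact mul_nonneg (by linarith [hm h]) (by linarith)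
      · exact mul_nonneg_of_nonpos_of_nonpos (by linarith [hm h]) (by linarith)
  simp only [sub_self, mul_zero, sub_zero] at h
  linarith

/-- Between x and y all points have absolute value at most x + 2, even when y is negative, so the
slope at x + 2 bounds the second derivative there. -/
lemma gTildeInt_le_taylor (hn : 0 < n) (hZ : 0 < Z) {x y : ℝ} (hx : 0 ≤ x) (hy : |y - x| ≤ 2) :
    gTildeInt n Z y ≤ gTildeInt n Z x + gTilde n Z x * (y - x)
      + gTildeSlope n Z (x + 2) * (y - x) ^ 2 / 2 := by
  set M := gTildeSlope n Z (x + 2)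
  obtain ⟨hy1, hy2⟩ := abs_le.1 hy
  have hint : ∀ t ∈ uIcc x y, |t| ≤ x + 2 := fun t ht => by
    obtain ⟨h1, h2⟩ := ht
    rw [abs_le]
    constructor
    · have : x - 2 ≤ min x y := le_min (by linarith) (by linarith)
      linarith
    · have : max x y ≤ x + 2 := max_le (by linarith) (by linarith)
      linarith
  have slope : ∀ t ∈ uIcc x y, 0 ≤ (M * (t - x) - (gTilde n Z t - gTilde n Z x)) * (t - x) := by
    intro t ht
    have hsub : uIcc x t ⊆ uIcc x y := uIcc_subset_uIcc left_mem_uIcc ht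
    have hM : ∀ s ∈ uIcc x t, gTildeSlope n Z s ≤ M := fun s hs =>
      gTildeSlope_le_gTildeSlope hn hZ (hint s (hsub hs))
    rcases le_total x t with hxt | hxt
    · have := le_of_hasDerivAt_mul_nonneg (φ := fun s => M * s - gTilde n Z s)
        (fun s => ((hasDerivAt_id s).const_mul M).sub (hasDerivAt_gTilde hn s)) (x := x) (y := t)
        fun s hs => by
          have := hM s hs
          rw [uIcc_of_le hxt] at hs
          exact mul_nonneg (by linarith) (by linarith [hs.1])
      exact mul_nonneg (by linarith) (by linarith)
    · have := le_of_hasDerivAt_mul_nonneg (φ := fun s => gTilde n Z s - M * s)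
        (fun s => (hasDerivAt_gTilde hn s).sub ((hasDerivAt_id s).const_mul M)) (x := x) (y := t)
        fun s hs => by
          have := hM s hs
          rw [uIcc_of_ge hxt] at hs
          exact mul_nonneg_of_nonpos_of_nonpos (by linarith) (by linarith [hs.2])
      exact mul_nonneg_of_nonpos_of_nonpos (by linarith) (by linarith)
  have h := le_of_hasDerivAt_mul_nonneg
    (φ := fun y => gTilde n Z x * (y - x) + M * (y - x) ^ 2 / 2 - gTildeInt n Z y)
    (φ' := fun t => gTilde n Z x * 1 + M * (2 * (t - x)) / 2 - gTilde n Z t)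
    (fun t => by
      have h1 := (hasDerivAt_id t).sub_const x
      have h2 := ((h1.pow 2).const_mul M).div_const 2
      have h3 := ((h1.const_mul (gTilde n Z x)).add h2).sub (hasDerivAt_gTildeInt (Z := Z) hn t)
      refine h3.congr_deriv ?_
      simp)
    (x := x) (y := y) fun t ht => by
      have := slope t ht
      convert this using 2
      ring
  simp only [sub_self, mul_zero] at h
  nlinarith

/-- Writing S for the slope, S' = (g + t S) / (8n) ≤ t S / (4n), so S(t) exp (-t² / (8n)) decreases
on t ≥ 0. Moving from x to x + 2 then costs a factor exp ((x + 1) / (2n)), which is less than 2. -/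
lemma gTildeSlope_add_two_le (hn : 8 ≤ n) (hZ : 0 < Z) {x : ℝ} (hx : 0 ≤ x) (hxn : x ≤ n) :
    gTildeSlope n Z (x + 2) ≤ 2 * gTildeSlope n Z x := by
  have hn0 : 0 < n := by linarith
  have h := le_of_hasDerivAt_mul_nonneg
    (φ := fun x => -(gTildeSlope n Z x * exp (-x ^ 2 / (8 * n))))
    (φ' := fun t => (t / (4 * n) * gTildeSlope n Z t
      - (gTilde n Z t + t * gTildeSlope n Z t) / (8 * n)) * exp (-t ^ 2 / (8 * n)))
    (fun t => by
      have h1 := ((hasDerivAt_pow 2 t).neg.div_const (8 * n)).exp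
      refine ((hasDerivAt_gTildeSlope hn0 t).mul h1).neg.congr_deriv ?_
      simp only [Nat.cast_ofNat, Pi.neg_apply]
      field_simp
      ring)
    (x := x) (y := x + 2) fun t ht => by
      rw [uIcc_of_le (by linarith)] at ht
      have h1 := gTilde_le_mul_gTildeSlope hn0 hZ (hx.trans ht.1)
      refine mul_nonneg (mul_nonneg ?_ (exp_pos _).le) (by linarith [ht.1])
      rw [show t / (4 * n) * gTildeSlope n Z t - (gTilde n Z t + t * gTildeSlope n Z t) / (8 * n)
        = (t * gTildeSlope n Z t - gTilde n Z t) / (8 * n) by field_simp; ring]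
      exact div_nonneg (by linarith) (by linarith)
  simp only [neg_le_neg_iff] at h
  have hS := gTildeSlope_pos hn0 hZ x
  have he : exp (-x ^ 2 / (8 * n)) ≤ 2 * exp (-(x + 2) ^ 2 / (8 * n)) := by
    have h2 : -x ^ 2 / (8 * n) ≤ log 2 + -(x + 2) ^ 2 / (8 * n) := by
      have h3 := log_two_gt_d9
      -- The value 9/16 = 1/2 + 1/16 comes from x ≤ n and n ≥ 8, and lies below log 2.
      have h4 : (x + 1) / (2 * n) ≤ 9 / 16 := by
        rw [div_le_iff₀ (by linarith)]; linarith
      have h5 : -x ^ 2 / (8 * n) - -(x + 2) ^ 2 / (8 * n) = (x + 1) / (2 * n) := by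
        field_simp; ring
      linarith
    calc _ ≤ exp (log 2 + -(x + 2) ^ 2 / (8 * n)) := exp_le_exp.2 h2
      _ = _ := by rw [exp_add, exp_log (by norm_num)]
  have hp := exp_pos (-(x + 2) ^ 2 / (8 * n))
  refine le_of_mul_le_mul_right ?_ hp
  calc _ ≤ _ := h
    _ ≤ gTildeSlope n Z x * (2 * exp (-(x + 2) ^ 2 / (8 * n))) := by gcongr
    _ = _ := by ring

/-- One step of the discounted process increases the discounted potential by at most the payoff
`b * gTilde n Z x`, up to `Z`. -/
lemma gTildeInt_step (hn : 8 ≤ n) (hZ : 0 < Z) {x b : ℝ} (hx : 0 ≤ x) (hxn : x ≤ n)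
    (hb : |b| ≤ 1) :
    gTildeInt n Z ((1 - 1 / n) * x + b)
      ≤ (1 - 1 / n) * gTildeInt n Z x + b * gTilde n Z x + Z := by
  have hn0 : 0 < n := by linarith
  obtain ⟨hb1, hb2⟩ := abs_le.1 hb
  have hxn1 : x / n ≤ 1 := (div_le_one hn0).2 hxn
  have hxn0 : 0 ≤ x / n := by positivity
  have hy : (1 - 1 / n) * x + b - x = b - x / n := by ring
  have hT := gTildeInt_le_taylor hn0 hZ (y := (1 - 1 / n) * x + b) hx
    (by rw [hy, abs_le]; constructor <;> linarith)
  rw [hy] at hT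
  have h2 := gTildeSlope_add_two_le hn hZ hx hxn
  have h3 : (b - x / n) ^ 2 ≤ 4 := by nlinarith
  have hM := gTildeSlope_pos hn0 hZ (x + 2)
  -- The quadratic cost is at most 2 S(x) · 4 / 2, where S is the slope; the differential equation
  -- makes this exactly half of the drift plus Z / 2.
  have h4 : gTildeSlope n Z (x + 2) * (b - x / n) ^ 2 / 2 ≤ 4 * gTildeSlope n Z x := by nlinarith
  have h5 : 4 * gTildeSlope n Z x = x * gTilde n Z x / 2 / n + Z / 2 := by
    rw [gTildeSlope]; field_simp; ring
  have h6 : gTildeInt n Z x / n ≤ x * gTilde n Z x / 2 / n :=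
    div_le_div_of_nonneg_right (gTildeInt_le_mul_gTilde_div_two hn0 hZ hx) hn0.le
  have h7 : gTilde n Z x * (b - x / n) = b * gTilde n Z x - 2 * (x * gTilde n Z x / 2 / n) := by
    field_simp
  have h8 : (1 - 1 / n) * gTildeInt n Z x = gTildeInt n Z x - gTildeInt n Z x / n := by ring
  linarith

/-- The value of `gTilde` at an explicit upper bound of the threshold. -/
lemma one_le_gTilde (hn : 8 * exp 1 ≤ n) (hZ : 0 < Z) (hZ1 : 1 / 2 ≤ log (1 / Z)) :
    1 ≤ gTilde n Z (4 * √(n * log (1 / Z))) := by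
  have hn0 : 0 < n := lt_of_lt_of_le (by positivity) hn
  have hL : 0 < log (1 / Z) := by linarith
  have h1 : exp ((4 * √(n * log (1 / Z))) ^ 2 / (16 * n)) = 1 / Z := by
    rw [mul_pow, sq_sqrt (by positivity)]
    rw [show 4 ^ 2 * (n * log (1 / Z)) / (16 * n) = log (1 / Z) by field_simp; norm_num]
    exact exp_log (by positivity)
  -- The exponential factor cancels Z, so it remains that √(n / 8) times the error function is at
  -- least 1: the former is at least exp (1/2), the latter at least erf 1 ≥ exp (-1/2).
  have h2 : exp (1 / 2) ≤ √(n / 8) := by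
    apply le_sqrt_of_sq_le
    rw [← exp_nat_mul]
    norm_num
    linarith
  have h3 : 1 ≤ 4 * √(n * log (1 / Z)) / √(8 * n) := by
    rw [le_div_iff₀ (by positivity), one_mul]
    rw [show (4 : ℝ) = √16 by rw [show (16 : ℝ) = 4 ^ 2 by norm_num]; simp,
      ← sqrt_mul (by norm_num)]
    exact sqrt_le_sqrt (by nlinarith)
  have h4 : exp (-(1 / 2)) ≤ erf (4 * √(n * log (1 / Z)) / √(8 * n)) :=
    exp_neg_half_le_erf_one.trans (strictMono_erf.monotone h3)
  rw [gTilde, h1]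
  calc (1 : ℝ) = exp (1 / 2) * exp (-(1 / 2)) := by rw [← exp_add]; simp
    _ ≤ √(n / 8) * erf (4 * √(n * log (1 / Z)) / √(8 * n)) := by gcongr
    _ = _ := by field_simp

/-- `Function.invFun` is meaningful only where a preimage exists; the intermediate value theorem
supplies one. -/
lemma gTilde_threshold (hn : 8 * exp 1 ≤ n) (hZ : 0 < Z) (hZ1 : 1 / 2 ≤ log (1 / Z)) :
    gTilde n Z (threshold n Z) = 1 := by
  have hn0 : 0 < n := lt_of_lt_of_le (by positivity) hn
  have h := intermediate_value_Icc (by positivity : 0 ≤ 4 * √(n * log (1 / Z)))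
    (continuous_gTilde (Z := Z) hn0).continuousOn
  obtain ⟨x, -, hx⟩ := h ⟨by simp, one_le_gTilde hn hZ hZ1⟩
  exact Function.invFun_eq ⟨x, hx⟩

lemma threshold_le (hn : 8 * exp 1 ≤ n) (hZ : 0 < Z) (hZ1 : 1 / 2 ≤ log (1 / Z)) :
    threshold n Z ≤ 4 * √(n * log (1 / Z)) := by
  have hn0 : 0 < n := lt_of_lt_of_le (by positivity) hn
  rw [← (strictMono_gTilde hn0 hZ).le_iff_le, gTilde_threshold hn hZ hZ1]
  exact one_le_gTilde hn hZ hZ1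

lemma threshold_le_window (hn : 8 * exp 1 ≤ n) (hZ : 0 < Z) (hZ1 : 1 / 2 ≤ log (1 / Z))
    (hn' : 16 * log (1 / Z) ≤ n) : threshold n Z ≤ n := by
  have hn0 : 0 < n := lt_of_lt_of_le (by positivity) hn
  refine (threshold_le hn hZ hZ1).trans ?_
  have : √(n * log (1 / Z)) ≤ n / 4 := by
    apply sqrt_le_iff.2
    constructor
    · positivity
    · nlinarith
  linarith

lemma threshold_pos (hn : 8 * exp 1 ≤ n) (hZ : 0 < Z) (hZ1 : 1 / 2 ≤ log (1 / Z)) :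
    0 < threshold n Z := by
  have hn0 : 0 < n := lt_of_lt_of_le (by positivity) hn
  rw [← (strictMono_gTilde hn0 hZ).lt_iff_lt, gTilde_threshold hn hZ hZ1]
  simp

lemma confidence_nonneg (x : ℝ) : 0 ≤ confidence n Z x := le_max_left _ _

lemma confidence_le_one (x : ℝ) : confidence n Z x ≤ 1 :=
  max_le zero_le_one (min_le_left _ _)

end Confidence

end SmoothedOGD

namespace SmoothedOGD

open Real Set

/-! ### Discounted sums -/

lemma sum_discount_succ (lam : ℝ) (a : ℕ → ℝ) (T : ℕ) :
    ∑ t ∈ Finset.range (T + 1), lam ^ (T + 1 - 1 - t) * a t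
      = lam * ∑ t ∈ Finset.range T, lam ^ (T - 1 - t) * a t + a T := by
  rw [Finset.sum_range_succ, Finset.mul_sum]
  congr 1
  · refine Finset.sum_congr rfl fun t ht => ?_
    have := Finset.mem_range.1 ht
    rw [← mul_assoc, ← pow_succ', show T + 1 - 1 - t = T - 1 - t + 1 by omega]
  · simp

/-! ### The predictor -/

section Predictor

/-- The potential of the predictor: the primitive of its confidence function. -/
noncomputable def potential (n Z x : ℝ) : ℝ :=
  if x ≤ 0 then 0
  else if x ≤ threshold n Z then gTildeInt n Z x
  else gTildeInt n Z (threshold n Z) + (x - threshold n Z)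

/-- The conditions on the window length `n` and on `Z` under which the predictor is analysed. -/
structure Admissible (n Z : ℝ) : Prop where
  exp_le : 8 * exp 1 ≤ n
  log_le : 16 * log (1 / Z) ≤ n
  pos : 0 < Z
  half_le : 1 / 2 ≤ log (1 / Z)

variable {n Z : ℝ}

lemma potential_of_mem {x : ℝ} (hx : 0 ≤ x) (hx' : x ≤ threshold n Z) :
    potential n Z x = gTildeInt n Z x := by
  rcases hx.eq_or_lt with rfl | hx
  · simp [potential]
  · rw [potential, if_neg (by linarith), if_pos hx']

namespace Admissible

lemma eight_le (h : Admissible n Z) : 8 ≤ n := by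
  have := h.exp_le
  have := add_one_le_exp (1 : ℝ)
  linarith

lemma window_pos (h : Admissible n Z) : 0 < n := by linarith [h.eight_le]

lemma threshold_pos (h : Admissible n Z) : 0 < threshold n Z :=
  SmoothedOGD.threshold_pos h.exp_le h.pos h.half_le

lemma gTilde_threshold (h : Admissible n Z) : gTilde n Z (threshold n Z) = 1 :=
  SmoothedOGD.gTilde_threshold h.exp_le h.pos h.half_le

lemma threshold_le_window (h : Admissible n Z) : threshold n Z ≤ n :=
  SmoothedOGD.threshold_le_window h.exp_le h.pos h.half_le h.log_le

lemma monotone_gTilde (h : Admissible n Z) : Monotone (gTilde n Z) :=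
  (strictMono_gTilde h.window_pos h.pos).monotone

lemma confidence_of_nonpos (h : Admissible n Z) {x : ℝ} (hx : x ≤ 0) : confidence n Z x = 0 := by
  have h1 := h.monotone_gTilde hx
  rw [gTilde_zero] at h1
  exact max_eq_left ((min_le_right _ _).trans h1)

lemma confidence_of_mem (h : Admissible n Z) {x : ℝ} (hx : 0 ≤ x) (hx' : x ≤ threshold n Z) :
    confidence n Z x = gTilde n Z x := by
  have h1 := h.monotone_gTilde hx
  have h2 := h.monotone_gTilde hx'
  rw [gTilde_zero] at h1
  rw [h.gTilde_threshold] at h2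
  rw [confidence, min_eq_right h2, max_eq_right h1]

lemma confidence_of_ge (h : Admissible n Z) {x : ℝ} (hx : threshold n Z ≤ x) :
    confidence n Z x = 1 := by
  have h2 := h.monotone_gTilde hx
  rw [h.gTilde_threshold] at h2
  rw [confidence, min_eq_left h2, max_eq_right zero_le_one]

lemma gTildeInt_nonneg (h : Admissible n Z) (x : ℝ) : 0 ≤ gTildeInt n Z x := by
  simpa using gTildeInt_add_mul_le h.window_pos h.pos 0 x

lemma potential_nonneg (h : Admissible n Z) (x : ℝ) : 0 ≤ potential n Z x := by
  unfold potential
  split_ifs with h1 h2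
  · rfl
  · exact h.gTildeInt_nonneg x
  · linarith [h.gTildeInt_nonneg (threshold n Z)]

/-- Above the threshold the potential is the tangent to the convex primitive, whose slope there is
1; below zero it is 0. -/
lemma potential_le (h : Admissible n Z) (x : ℝ) : potential n Z x ≤ gTildeInt n Z x := by
  unfold potential
  split_ifs with h1 h2
  · exact h.gTildeInt_nonneg x
  · rfl
  · have := gTildeInt_add_mul_le h.window_pos h.pos (threshold n Z) x
    rwa [h.gTilde_threshold, one_mul] at this

lemma potential_of_ge (h : Admissible n Z) {x : ℝ} (hx : threshold n Z ≤ x) :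
    potential n Z x = potential n Z (threshold n Z) + (x - threshold n Z) := by
  have h0 := h.threshold_pos
  rw [potential_of_mem h0.le le_rfl]
  rcases hx.eq_or_lt with rfl | hx
  · rw [potential_of_mem h0.le le_rfl]; ring
  · rw [potential, if_neg (by linarith), if_neg (by linarith)]

lemma sub_potential_le (h : Admissible n Z) {x : ℝ} (hx : x ≤ threshold n Z + 1) :
    x - potential n Z x ≤ threshold n Z + 1 := by
  linarith [h.potential_nonneg x]

lemma potential_step_of_mem (h : Admissible n Z) {x b : ℝ} (hx : 0 ≤ x)
    (hx' : x ≤ threshold n Z) (hb : |b| ≤ 1) :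
    potential n Z ((1 - 1 / n) * x + b)
      ≤ (1 - 1 / n) * potential n Z x + b * confidence n Z x + Z := by
  rw [potential_of_mem hx hx', h.confidence_of_mem hx hx']
  exact (h.potential_le _).trans
    (gTildeInt_step h.eight_le h.pos hx (hx'.trans h.threshold_le_window) hb)

lemma discount_nonneg (h : Admissible n Z) : 0 ≤ 1 - 1 / n := by
  have := h.eight_le
  have : 1 / n ≤ 1 := (div_le_one (by linarith)).2 (by linarith)
  linarith

/-- The potential has slope 1 above the threshold U, so the discounted excess ρ (x - U) can be
absorbed into the bit. The step then starts at U with a modified bit still in [-1, 1]. -/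
lemma potential_step_of_ge (h : Admissible n Z) {x b : ℝ} (hx : threshold n Z ≤ x)
    (hx' : x ≤ threshold n Z + 1) (hb : |b| ≤ 1) (hb' : b ≤ 0) :
    potential n Z ((1 - 1 / n) * x + b)
      ≤ (1 - 1 / n) * potential n Z x + b * confidence n Z x + Z := by
  have h0 := h.discount_nonneg
  have h1 : 0 ≤ 1 / n := by have := h.window_pos; positivity
  obtain ⟨hb1, -⟩ := abs_le.1 hb
  have key := h.potential_step_of_mem (b := (1 - 1 / n) * (x - threshold n Z) + b)
    h.threshold_pos.le le_rfl (by rw [abs_le]; constructor <;> nlinarith)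
  rw [h.confidence_of_ge le_rfl] at key
  rw [h.confidence_of_ge hx, h.potential_of_ge hx,
    show (1 - 1 / n) * x + b = (1 - 1 / n) * threshold n Z
      + ((1 - 1 / n) * (x - threshold n Z) + b) by ring]
  linarith

/-- A positive y is reached in one step from state 0, where confidence and potential both vanish. -/
lemma potential_le_of_le_one (h : Admissible n Z) {y : ℝ} (hy : y ≤ 1) :
    potential n Z y ≤ Z := by
  rcases le_total y 0 with hy0 | hy0
  · rw [potential, if_pos hy0]; exact h.pos.le
  · have := h.potential_step_of_mem (x := 0) (b := y) le_rfl h.threshold_pos.le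
      (by rwa [abs_of_nonneg hy0])
    simpa [potential, h.confidence_of_nonpos le_rfl, h.threshold_pos.le] using this

end Admissible

variable {ρ : ℝ} {b : ℕ → ℝ}

lemma one_sub_one_div_window (ρ : ℝ) : 1 - 1 / window ρ = ρ := by
  simp [window]

/-- Above the threshold only negative bits are added, so an overshoot is at most one bit. -/
lemma dnpUpdate_le (h : Admissible (window ρ) Z) {x b : ℝ}
    (hx : x ≤ threshold (window ρ) Z + 1) (hb : b ≤ 1) :
    dnpUpdate ρ Z x b ≤ threshold (window ρ) Z + 1 := by
  have h0 := h.discount_nonneg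
  have h1 : 0 ≤ 1 / window ρ := by have := h.window_pos; positivity
  have h2 := h.threshold_pos
  have h3 := one_sub_one_div_window ρ
  rw [h3] at h0
  unfold dnpUpdate
  split_ifs with hc
  · rcases hc with hc | hc | hc <;> nlinarith
  · rcases le_total 0 x with hx0 | hx0 <;> nlinarith

lemma dnpState_le (h : Admissible (window ρ) Z) {T : ℕ} (hb : ∀ t < T, |b t| ≤ 1) :
    ∀ t ≤ T, dnpState ρ Z b t ≤ threshold (window ρ) Z + 1
  | 0, _ => by have := h.threshold_pos; simp only [dnpState]; linarith
  | t + 1, ht => dnpUpdate_le h (dnpState_le h hb t (by omega)) (abs_le.1 (hb t (by omega))).2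

/-- One step of the predictor: its payoff dominates the increment of the discounted potential, and
its loss against the constant prediction `1` is bounded by the increments of the state and of the
potential. -/
lemma dnpUpdate_step (h : Admissible (window ρ) Z) {x b : ℝ}
    (hx : x ≤ threshold (window ρ) Z + 1) (hb : |b| ≤ 1) :
    potential (window ρ) Z (dnpUpdate ρ Z x b)
        ≤ ρ * potential (window ρ) Z x + b * confidence (window ρ) Z x + Z ∧
      b * (1 - confidence (window ρ) Z x)
        ≤ dnpUpdate ρ Z x b - ρ * x - potential (window ρ) Z (dnpUpdate ρ Z x b)
          + ρ * potential (window ρ) Z x + Z := by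
  have hρ := one_sub_one_div_window ρ
  have h0 := h.discount_nonneg
  rw [hρ] at h0
  have h2 := h.threshold_pos
  obtain ⟨hb1, hb2⟩ := abs_le.1 hb
  have hZ := h.pos
  unfold dnpUpdate
  split_ifs with hc
  · have key : potential (window ρ) Z (ρ * x + b)
        ≤ ρ * potential (window ρ) Z x + b * confidence (window ρ) Z x + Z := by
      rcases hc with hc | hc | hc
      · have := h.potential_step_of_mem hc.1 hc.2 hb
        rwa [hρ] at this
      · rw [h.confidence_of_nonpos hc.1.le]
        have h3 := h.potential_le_of_le_one (y := ρ * x + b) (by nlinarith)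
        have h4 := mul_nonneg h0 (h.potential_nonneg x)
        linarith
      · have := h.potential_step_of_ge hc.1.le hx hb hc.2.le
        rwa [hρ] at this
    exact ⟨key, by linarith⟩
  -- A dropped bit favours the prediction already made: b ≤ 0 with confidence 0, or b ≥ 0 with
  -- confidence 1. In the second case the potential is controlled by a step with bit 0.
  · push Not at hc
    rcases lt_or_ge x 0 with hx0 | hx0
    · have hb0 := hc.2.1 hx0
      have h3 := h.potential_le_of_le_one (y := ρ * x) (by nlinarith)
      have h4 := mul_nonneg h0 (h.potential_nonneg x)
      rw [h.confidence_of_nonpos hx0.le]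
      constructor <;> linarith
    · have hxU := hc.1 hx0
      have hb0 := hc.2.2 hxU
      have h3 := h.potential_step_of_ge (b := 0) hxU.le hx (by simp) le_rfl
      rw [hρ, add_zero, zero_mul, add_zero] at h3
      rw [h.confidence_of_ge hxU.le]
      constructor <;> linarith

variable {lam : ℝ} {T : ℕ}

/-- Against the constant prediction `0`, the predictor loses at most `Z / (1 - lam)`. -/
theorem dnpPredict_payoff_ge (h : Admissible (window ρ) Z) (hlam : ρ ≤ lam) (hlam1 : lam < 1)
    (hb : ∀ t < T, |b t| ≤ 1) :
    -(Z / (1 - lam))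
      ≤ ∑ t ∈ Finset.range T, lam ^ (T - 1 - t) * (b t * dnpPredict ρ Z b t) := by
  have h0 := h.discount_nonneg
  rw [one_sub_one_div_window ρ] at h0
  have h1 : 0 < 1 - lam := by linarith
  -- The accumulated error is the fixed point of c ↦ λc + Z; replacing ρ by λ in front of the
  -- potential is allowed because the potential is nonnegative.
  have hc : lam * (Z / (1 - lam)) + Z = Z / (1 - lam) := by field_simp; ring
  have key : ∀ k ≤ T, potential (window ρ) Z (dnpState ρ Z b k) - Z / (1 - lam)
      ≤ ∑ t ∈ Finset.range k, lam ^ (k - 1 - t) * (b t * dnpPredict ρ Z b t) := by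
    intro k
    induction k with
    | zero =>
      intro _
      have := h.pos
      simp only [dnpState, potential, le_refl, if_true, Finset.range_zero, Finset.sum_empty]
      have : 0 ≤ Z / (1 - lam) := by positivity
      linarith
    | succ k ih =>
      intro hk
      have h2 := mul_le_mul_of_nonneg_left (ih (by omega)) (h0.trans hlam)
      have h3 := (dnpUpdate_step h (dnpState_le h hb k (by omega)) (hb k (by omega))).1
      have h4 := mul_le_mul_of_nonneg_right hlam (h.potential_nonneg (dnpState ρ Z b k))
      rw [sum_discount_succ]
      simp only [dnpPredict, dnpState] at *
      linarith
  have := key T le_rfl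
  linarith [h.potential_nonneg (dnpState ρ Z b T)]

/-- The discounted regret of the predictor against the constant prediction `1`. -/
theorem dnpPredict_regret_le (h : Admissible (window ρ) Z) (hlam : ρ ≤ lam) (hlam1 : lam < 1)
    (hb : ∀ t < T, |b t| ≤ 1) :
    ∑ t ∈ Finset.range T, lam ^ (T - 1 - t) * (b t * (1 - dnpPredict ρ Z b t))
      ≤ (threshold (window ρ) Z + 1) * ((1 - ρ) / (1 - lam)) + Z / (1 - lam) := by
  have h0 := h.discount_nonneg
  rw [one_sub_one_div_window ρ] at h0
  have h1 : 0 < 1 - lam := by linarith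
  have hU := h.threshold_pos
  have hZ := h.pos
  set U := threshold (window ρ) Z with hU'
  -- Discounting by λ instead of ρ leaves an extra (λ - ρ) x ≤ (λ - ρ)(U + 1) per round; c is the
  -- fixed point that absorbs it together with Z.
  obtain ⟨c, hc'⟩ : ∃ c, c = ((lam - ρ) * (U + 1) + Z) / (1 - lam) := ⟨_, rfl⟩
  have hc : lam * c + ((lam - ρ) * (U + 1) + Z) = c := by rw [hc']; field_simp; ring
  have hc0 : 0 ≤ c := by
    rw [hc']
    exact div_nonneg (add_nonneg (mul_nonneg (by linarith) (by linarith)) hZ.le) h1.le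
  have key : ∀ k ≤ T, ∑ t ∈ Finset.range k, lam ^ (k - 1 - t) * (b t * (1 - dnpPredict ρ Z b t))
      ≤ dnpState ρ Z b k - potential (window ρ) Z (dnpState ρ Z b k) + c := by
    intro k
    induction k with
    | zero => intro _; simpa [dnpState, potential] using hc0
    | succ k ih =>
      intro hk
      have hs := dnpState_le h hb k (by omega)
      have h2 := mul_le_mul_of_nonneg_left (ih (by omega)) (h0.trans hlam)
      have h3 := (dnpUpdate_step h hs (hb k (by omega))).2
      have h4 := mul_le_mul_of_nonneg_right hlam (h.potential_nonneg (dnpState ρ Z b k))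
      have h5 := mul_le_mul_of_nonneg_left hs (sub_nonneg.2 hlam)
      rw [sum_discount_succ]
      simp only [dnpPredict, dnpState] at *
      linarith
  have h2 := key T le_rfl
  have h3 := h.sub_potential_le (dnpState_le h hb T le_rfl)
  have h4 : (U + 1) * ((1 - ρ) / (1 - lam)) + Z / (1 - lam) = U + 1 + c := by
    rw [hc']; field_simp; ring
  linarith

end Predictor

end SmoothedOGD

namespace SmoothedOGD

open Real Set

variable {E : Type*} [NormedAddCommGroup E] [InnerProductSpace ℝ E]

/-! ### Projection -/

lemma proj_spec {W : Set E} (hne : W.Nonempty) (hc : IsComplete W) (hW : Convex ℝ W) (x : E) :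
    proj W x ∈ W ∧ ∀ q ∈ W, ‖x - proj W x‖ ≤ ‖x - q‖ := by
  obtain ⟨p, hp, hpe⟩ := exists_norm_eq_iInf_of_complete_convex hne hc hW x
  refine Classical.epsilon_spec (p := fun p => p ∈ W ∧ ∀ q ∈ W, ‖x - p‖ ≤ ‖x - q‖) ⟨p, hp, ?_⟩
  intro q hq
  rw [hpe]
  exact ciInf_le (f := fun w : W => ‖x - w‖) ⟨0, Set.forall_mem_range.2 fun _ => norm_nonneg _⟩
    ⟨q, hq⟩

lemma norm_proj_sub_le {W : Set E} (hne : W.Nonempty) (hc : IsComplete W) (hW : Convex ℝ W)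
    (x : E) {w : E} (hw : w ∈ W) : ‖proj W x - w‖ ≤ ‖x - w‖ := by
  obtain ⟨hp, hmin⟩ := proj_spec hne hc hW x
  have : Nonempty W := hne.to_subtype
  have h : ‖x - proj W x‖ = ⨅ q : W, ‖x - q‖ :=
    le_antisymm (le_ciInf fun q => hmin q q.2)
      (ciInf_le (f := fun w : W => ‖x - w‖) ⟨0, Set.forall_mem_range.2 fun _ => norm_nonneg _⟩
        ⟨_, hp⟩)
  have h1 := (norm_eq_iInf_iff_real_inner_le_zero hW hp).1 h w hw
  have h2 : ‖x - w‖ ^ 2 = ‖x - proj W x‖ ^ 2 - 2 * inner ℝ (x - proj W x) (w - proj W x)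
      + ‖w - proj W x‖ ^ 2 := by
    rw [← norm_sub_sq_real]; congr 2; abel
  rw [norm_sub_rev (proj W x)]
  refine le_of_sq_le_sq ?_ (norm_nonneg _)
  nlinarith [sq_nonneg ‖x - proj W x‖]

/-! ### First-order inequality for convex functions -/

/-- On the segment from p to q, the one-sided derivative at p is at most the slope of the chord. The
gradient is only relative to W, so the derivative is taken within [0, 1]. -/
lemma sub_le_inner_of_hasGradientWithinAt [CompleteSpace E] {W : Set E} {f : E → ℝ} {g p q : E}
    (hf : ConvexOn ℝ W f) (hp : p ∈ W) (hq : q ∈ W) (hg : HasGradientWithinAt f g W p) :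
    f p - f q ≤ inner ℝ g (p - q) := by
  have hmaps : MapsTo (AffineMap.lineMap p q : ℝ → E) (Icc 0 1) W := fun s hs =>
    hf.1.lineMap_mem hp hq hs
  have hconv : ConvexOn ℝ (Icc (0 : ℝ) 1) (f ∘ (AffineMap.lineMap p q : ℝ →ᵃ[ℝ] E)) :=
    (hf.comp_affineMap _).subset hmaps (convex_Icc 0 1)
  have h0 : HasFDerivWithinAt f (InnerProductSpace.toDual ℝ E g) W
      ((AffineMap.lineMap p q : ℝ → E) 0) := by
    rw [AffineMap.lineMap_apply_zero]; exact hg.hasFDerivWithinAt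
  have hd := h0.comp_hasDerivWithinAt (0 : ℝ)
    (AffineMap.hasDerivWithinAt_lineMap (a := p) (b := q) (s := Icc 0 1)) hmaps
  have h := hconv.le_slope_of_hasDerivWithinAt (left_mem_Icc.2 zero_le_one)
    (right_mem_Icc.2 zero_le_one) zero_lt_one hd
  rw [InnerProductSpace.toDual_apply_apply, slope_def_field] at h
  simp only [Function.comp_apply, AffineMap.lineMap_apply_one, AffineMap.lineMap_apply_zero,
    sub_zero, div_one] at h
  rw [← neg_sub q p, inner_neg_right]
  linarith

/-! ### Online gradient descent -/

section OGD

variable {W : Set E} {grad : ℕ → E → E} {η G D : ℝ} {w₁ : E} {T : ℕ} {f : ℕ → E → ℝ}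

lemma ogd_mem (hne : W.Nonempty) (hc : IsComplete W) (hW : Convex ℝ W) (hw₁ : w₁ ∈ W) (t : ℕ) :
    ogd W grad η w₁ t ∈ W := by
  cases t with
  | zero => exact hw₁
  | succ t => exact (proj_spec hne hc hW _).1

/-- The discounted regret of online gradient descent. -/
theorem ogd_regret_le [CompleteSpace E] (hne : W.Nonempty) (hc : IsComplete W) (hW : Convex ℝ W)
    (hD : ∀ x ∈ W, ∀ y ∈ W, ‖x - y‖ ≤ D) (hf : ∀ t < T, ConvexOn ℝ W (f t))
    (hgrad : ∀ t < T, ∀ w ∈ W, HasGradientWithinAt (f t) (grad t w) W w)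
    (hG : ∀ t < T, ∀ w ∈ W, ‖grad t w‖ ≤ G) (hη : 0 < η) (hw₁ : w₁ ∈ W) {lam : ℝ}
    (hlam0 : 0 ≤ lam) (hlam1 : lam < 1) {w : E} (hw : w ∈ W) :
    ∑ t ∈ Finset.range T, lam ^ (T - 1 - t) * (f t (ogd W grad η w₁ t) - f t w)
      ≤ D ^ 2 / (2 * η) + η * G ^ 2 / 2 / (1 - lam) := by
  set u := ogd W grad η w₁ with hu
  have hmem : ∀ t, u t ∈ W := ogd_mem hne hc hW hw₁
  have h1 : 0 < 1 - lam := by linarith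
  have hdist : ∀ t, ‖u t - w‖ ^ 2 ≤ D ^ 2 := fun t =>
    pow_le_pow_left₀ (norm_nonneg _) (hD _ (hmem t) _ hw) 2
  have hstep : ∀ t < T, f t (u t) - f t w
      ≤ (‖u t - w‖ ^ 2 - ‖u (t + 1) - w‖ ^ 2) / (2 * η) + η * G ^ 2 / 2 := by
    intro t ht
    have h2 := sub_le_inner_of_hasGradientWithinAt (hf t ht) (hmem t) hw (hgrad t ht _ (hmem t))
    have h3 : ‖u (t + 1) - w‖ ^ 2 ≤ ‖u t - η • grad t (u t) - w‖ ^ 2 :=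
      pow_le_pow_left₀ (norm_nonneg _) (norm_proj_sub_le hne hc hW _ hw) 2
    have h4 : ‖u t - η • grad t (u t) - w‖ ^ 2
        = ‖u t - w‖ ^ 2 - 2 * (η * inner ℝ (grad t (u t)) (u t - w))
          + η ^ 2 * ‖grad t (u t)‖ ^ 2 := by
      rw [show u t - η • grad t (u t) - w = (u t - w) - η • grad t (u t) by abel,
        norm_sub_sq_real, inner_smul_right, real_inner_comm, norm_smul, mul_pow,
        norm_eq_abs, sq_abs]
    have h5 : ‖grad t (u t)‖ ^ 2 ≤ G ^ 2 :=
      pow_le_pow_left₀ (norm_nonneg _) (hG t ht _ (hmem t)) 2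
    have h6 : inner ℝ (grad t (u t)) (u t - w)
        ≤ (‖u t - w‖ ^ 2 - ‖u (t + 1) - w‖ ^ 2) / (2 * η) + η * G ^ 2 / 2 := by
      rw [div_add_div _ _ (by positivity) two_ne_zero, le_div_iff₀ (by positivity)]
      have := mul_le_mul_of_nonneg_left h5 (sq_nonneg η)
      nlinarith
    linarith
  have hc' : lam * (η * G ^ 2 / 2 / (1 - lam)) + η * G ^ 2 / 2 = η * G ^ 2 / 2 / (1 - lam) := by
    field_simp; ring
  have key : ∀ k ≤ T, ∑ t ∈ Finset.range k, lam ^ (k - 1 - t) * (f t (u t) - f t w)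
      ≤ (D ^ 2 - ‖u k - w‖ ^ 2) / (2 * η) + η * G ^ 2 / 2 / (1 - lam) := by
    intro k
    induction k with
    | zero =>
      intro _
      simp only [Finset.range_zero, Finset.sum_empty]
      have := sub_nonneg.2 (hdist 0)
      positivity
    | succ k ih =>
      intro hk
      have h2 := mul_le_mul_of_nonneg_left (ih (by omega)) hlam0
      have h3 := hstep k (by omega)
      -- Discounting breaks plain telescoping, but D² minus the squared distance is nonnegative, so
      -- its factor λ can be dropped.
      have h4 : lam * ((D ^ 2 - ‖u k - w‖ ^ 2) / (2 * η)) ≤ (D ^ 2 - ‖u k - w‖ ^ 2) / (2 * η) :=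
        mul_le_of_le_one_left (div_nonneg (sub_nonneg.2 (hdist k)) (by positivity)) hlam1.le
      rw [sum_discount_succ]
      have h5 : (D ^ 2 - ‖u k - w‖ ^ 2) / (2 * η)
          + (‖u k - w‖ ^ 2 - ‖u (k + 1) - w‖ ^ 2) / (2 * η)
          = (D ^ 2 - ‖u (k + 1) - w‖ ^ 2) / (2 * η) := by ring
      linarith
  refine (key T le_rfl).trans ?_
  gcongr
  linarith [sq_nonneg ‖u T - w‖]

end OGD

/-! ### Combiner -/

section Combiner

variable {W : Set E} {G D ρ Z lam : ℝ} {T : ℕ} {f : ℕ → E → ℝ} {p q : ℕ → E}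

lemma combiner_mem (hW : Convex ℝ W) {t : ℕ} (hp : p t ∈ W) (hq : q t ∈ W) :
    combiner G D f ρ Z p q t ∈ W :=
  hW hp hq (sub_nonneg.2 (confidence_le_one _)) (confidence_nonneg _) (by ring)

lemma abs_combinerBit_le [CompleteSpace E] {grad : ℕ → E → E} (hG0 : 0 < G) (hD0 : 0 < D)
    (hD : ∀ x ∈ W, ∀ y ∈ W, ‖x - y‖ ≤ D) {t : ℕ} (hf : ConvexOn ℝ W (f t))
    (hgrad : ∀ w ∈ W, HasGradientWithinAt (f t) (grad t w) W w)
    (hG : ∀ w ∈ W, ‖grad t w‖ ≤ G) (hp : p t ∈ W) (hq : q t ∈ W) :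
    |combinerBit G D f p q t| ≤ 1 := by
  have key : ∀ x ∈ W, ∀ y ∈ W, f t x - f t y ≤ G * D := fun x hx y hy =>
    calc f t x - f t y ≤ inner ℝ (grad t x) (x - y) :=
          sub_le_inner_of_hasGradientWithinAt hf hx hy (hgrad x hx)
      _ ≤ ‖grad t x‖ * ‖x - y‖ := real_inner_le_norm _ _
      _ ≤ G * D := mul_le_mul (hG x hx) (hD x hx y hy) (norm_nonneg _) hG0.le
  have hGD : 0 < G * D := mul_pos hG0 hD0
  rw [combinerBit, abs_div, abs_of_pos hGD, div_le_one hGD, abs_le]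
  constructor <;> linarith [key _ hp _ hq, key _ hq _ hp]

lemma apply_combiner_le (hG0 : 0 < G) (hD0 : 0 < D) {t : ℕ} (hf : ConvexOn ℝ W (f t))
    (hp : p t ∈ W) (hq : q t ∈ W) :
    f t (combiner G D f ρ Z p q t) ≤ f t (p t)
      - G * D * (combinerBit G D f p q t * dnpPredict ρ Z (combinerBit G D f p q) t) := by
  have h := hf.2 hp hq (sub_nonneg.2 (confidence_le_one _) :
    0 ≤ 1 - combinerWeight G D f ρ Z p q t) (confidence_nonneg _) (sub_add_cancel _ _)
  have hb : G * D * combinerBit G D f p q t = f t (p t) - f t (q t) := by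
    rw [combinerBit]; field_simp
  rw [← mul_assoc, hb, combiner]
  refine h.trans (le_of_eq ?_)
  change (1 - combinerWeight G D f ρ Z p q t) * f t (p t)
    + combinerWeight G D f ρ Z p q t * f t (q t) = _
  rw [combinerWeight]
  ring

lemma discountedLoss_combiner_le_left (h : Admissible (window ρ) Z) (hlam : ρ ≤ lam)
    (hlam1 : lam < 1) (hG0 : 0 < G) (hD0 : 0 < D) (hf : ∀ t < T, ConvexOn ℝ W (f t))
    (hp : ∀ t < T, p t ∈ W) (hq : ∀ t < T, q t ∈ W)
    (hb : ∀ t < T, |combinerBit G D f p q t| ≤ 1) :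
    discountedLoss f T lam (combiner G D f ρ Z p q)
      ≤ discountedLoss f T lam p + G * D * (Z / (1 - lam)) := by
  have h0 := h.discount_nonneg
  rw [one_sub_one_div_window ρ] at h0
  have key := mul_le_mul_of_nonneg_left (dnpPredict_payoff_ge h hlam hlam1 hb)
    (mul_pos hG0 hD0).le
  have hsum : discountedLoss f T lam (combiner G D f ρ Z p q)
      ≤ discountedLoss f T lam p - G * D * ∑ t ∈ Finset.range T, lam ^ (T - 1 - t) *
        (combinerBit G D f p q t * dnpPredict ρ Z (combinerBit G D f p q) t) := by
    rw [discountedLoss, discountedLoss, Finset.mul_sum, ← Finset.sum_sub_distrib]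
    refine Finset.sum_le_sum fun t ht => ?_
    have ht := Finset.mem_range.1 ht
    have := mul_le_mul_of_nonneg_left (apply_combiner_le (ρ := ρ) (Z := Z) hG0 hD0 (hf t ht)
      (hp t ht) (hq t ht)) (pow_nonneg (h0.trans hlam) (T - 1 - t))
    linarith
  linarith

lemma discountedLoss_combiner_le_right (h : Admissible (window ρ) Z) (hlam : ρ ≤ lam)
    (hlam1 : lam < 1) (hG0 : 0 < G) (hD0 : 0 < D) (hf : ∀ t < T, ConvexOn ℝ W (f t))
    (hp : ∀ t < T, p t ∈ W) (hq : ∀ t < T, q t ∈ W)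
    (hb : ∀ t < T, |combinerBit G D f p q t| ≤ 1) :
    discountedLoss f T lam (combiner G D f ρ Z p q)
      ≤ discountedLoss f T lam q + G * D *
        ((threshold (window ρ) Z + 1) * ((1 - ρ) / (1 - lam)) + Z / (1 - lam)) := by
  have h0 := h.discount_nonneg
  rw [one_sub_one_div_window ρ] at h0
  have key := mul_le_mul_of_nonneg_left (dnpPredict_regret_le h hlam hlam1 hb)
    (mul_pos hG0 hD0).le
  have hsum : discountedLoss f T lam (combiner G D f ρ Z p q)
      ≤ discountedLoss f T lam q + G * D * ∑ t ∈ Finset.range T, lam ^ (T - 1 - t) *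
        (combinerBit G D f p q t * (1 - dnpPredict ρ Z (combinerBit G D f p q) t)) := by
    rw [discountedLoss, discountedLoss, Finset.mul_sum, ← Finset.sum_add_distrib]
    refine Finset.sum_le_sum fun t ht => ?_
    have ht := Finset.mem_range.1 ht
    have h1 := apply_combiner_le (ρ := ρ) (Z := Z) hG0 hD0 (hf t ht) (hp t ht) (hq t ht)
    have hbt : G * D * combinerBit G D f p q t = f t (p t) - f t (q t) := by
      rw [combinerBit]; field_simp
    have h2 : f t (combiner G D f ρ Z p q t) ≤ f t (q t) + G * D *
        (combinerBit G D f p q t * (1 - dnpPredict ρ Z (combinerBit G D f p q) t)) := by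
      linarith
    have := mul_le_mul_of_nonneg_left h2 (pow_nonneg (h0.trans hlam) (T - 1 - t))
    linarith
  linarith

end Combiner

end SmoothedOGD

namespace SmoothedOGD

open Real Set

/-! ### Parameters -/

lemma window_discount_succ {T : ℕ} (k : ℕ) :
    window (discount T (k + 1)) = T / 2 ^ k := by
  simp [window, discount]

/-- Even the shortest window T / 2^N is at least τ / 2, which explains the factor 2 between the
bounds on τ and those in `Admissible`. -/
lemma admissible_window_discount {T N k : ℕ} {τ Z : ℝ} (hT : 0 < T) (hZ : Z = 1 / (T : ℝ))
    (hτe : 16 * exp 1 ≤ τ) (hτl : 32 * log (1 / Z) ≤ τ) (hτT : τ ≤ T)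
    (hN : 2 ^ N * τ ≤ 2 * T) (hk : k ≤ N) :
    Admissible (window (discount T (k + 1))) Z := by
  have hT' : (0 : ℝ) < T := by exact_mod_cast hT
  have he := add_one_le_exp (1 : ℝ)
  have hτ0 : 0 < τ := by linarith
  have hn : τ / 2 ≤ window (discount T (k + 1)) := by
    rw [window_discount_succ, div_le_div_iff₀ two_pos (by positivity)]
    have : (2 : ℝ) ^ k ≤ 2 ^ N := pow_le_pow_right₀ one_le_two hk
    nlinarith
  refine ⟨by linarith, by linarith, by rw [hZ]; positivity, ?_⟩
  have h1 : 1 / Z = T := by rw [hZ, one_div_one_div]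
  rw [h1, le_log_iff_exp_le hT']
  have : exp (1 / 2) ≤ exp 1 := exp_le_exp.2 (by norm_num)
  linarith

lemma two_pow_ceil_logb {x : ℝ} (hx : 1 ≤ x) :
    x ≤ 2 ^ ⌈logb 2 x⌉₊ ∧ (2 : ℝ) ^ ⌈logb 2 x⌉₊ ≤ 2 * x := by
  have hx0 : 0 < x := by linarith
  have hp : (2 : ℝ) ^ logb 2 x = x := rpow_logb two_pos (by norm_num) hx0
  constructor
  · calc x = (2 : ℝ) ^ logb 2 x := hp.symm
      _ ≤ (2 : ℝ) ^ (⌈logb 2 x⌉₊ : ℝ) := rpow_le_rpow_of_exponent_le one_le_two (Nat.le_ceil _)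
      _ = _ := rpow_natCast _ _
  · calc (2 : ℝ) ^ ⌈logb 2 x⌉₊ = (2 : ℝ) ^ (⌈logb 2 x⌉₊ : ℝ) := (rpow_natCast _ _).symm
      _ ≤ (2 : ℝ) ^ (logb 2 x + 1) := rpow_le_rpow_of_exponent_le one_le_two
          (Nat.ceil_lt_add_one (logb_nonneg one_lt_two hx)).le
      _ = 2 * x := by rw [rpow_add two_pos, hp, rpow_one, mul_comm]

/-- Take the least k with δ ≤ 2^k / T: minimality gives the factor 2, and for k = 0 the bound 1 / T
≤ δ does. -/
lemma exists_two_pow_div_mem_Icc {T N : ℕ} {δ : ℝ} (hT : 0 < T) (h1 : 1 / (T : ℝ) ≤ δ)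
    (hN : δ ≤ 2 ^ N / T) : ∃ k ≤ N, δ ≤ 2 ^ k / T ∧ (2 : ℝ) ^ k / T ≤ 2 * δ := by
  classical
  have hT' : (0 : ℝ) < T := by exact_mod_cast hT
  have hδ : 0 < δ := lt_of_lt_of_le (by positivity) h1
  have hex : ∃ k : ℕ, δ ≤ 2 ^ k / T := ⟨N, hN⟩
  refine ⟨Nat.find hex, Nat.find_min' hex hN, Nat.find_spec hex, ?_⟩
  rcases hk : Nat.find hex with _ | k
  · rw [pow_zero]; linarith
  · have h := Nat.find_min hex (m := k) (by omega)
    push Not at h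
    rw [pow_succ, mul_div_right_comm]
    linarith

lemma succ_sq_le_four_mul_two_pow (N : ℕ) : (N + 1) ^ 2 ≤ 4 * 2 ^ N := by
  induction N with
  | zero => norm_num
  | succ N ih =>
    rcases Nat.lt_or_ge N 2 with h | h
    · interval_cases N <;> norm_num
    · rw [pow_succ 2 N]; nlinarith

lemma discountedLoss_sub {α : Type*} (f : ℕ → α → ℝ) (T : ℕ) (lam : ℝ) (u v : ℕ → α) :
    discountedLoss f T lam u - discountedLoss f T lam v
      = ∑ t ∈ Finset.range T, lam ^ (T - 1 - t) * (f t (u t) - f t (v t)) := by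
  simp only [discountedLoss, ← Finset.sum_sub_distrib, mul_sub]

variable {E : Type*} [NormedAddCommGroup E] [InnerProductSpace ℝ E]

/-! ### Aggregates -/

section Aggregate

variable {W : Set E} {G D Z lam τ : ℝ} {T N : ℕ} {f : ℕ → E → ℝ} {grad : ℕ → E → E}
  {base start : ℕ → E}

lemma expert_mem (hne : W.Nonempty) (hc : IsComplete W) (hW : Convex ℝ W)
    (hstart : ∀ i, 1 ≤ i → i ≤ N + 1 → start i ∈ W) {i : ℕ} (hi : i < N + 1) (t : ℕ) :
    expert W G D grad T start (i + 1) t ∈ W :=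
  ogd_mem hne hc hW (hstart (i + 1) (by omega) (by omega)) t

lemma aggregate_mem (hne : W.Nonempty) (hc : IsComplete W) (hW : Convex ℝ W)
    (hbase : ∀ t < T, base t ∈ W) (hstart : ∀ i, 1 ≤ i → i ≤ N + 1 → start i ∈ W) {i : ℕ}
    (hi : i ≤ N + 1) : ∀ t < T, aggregate W G D f grad T Z base start i t ∈ W := by
  induction i with
  | zero => exact hbase
  | succ i ih =>
    exact fun t ht => combiner_mem hW (ih (by omega) t ht) (expert_mem hne hc hW hstart hi t)

/-- Later levels have smaller discount factors, so each compares with its first algorithm at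
discount λ and adds one error term. -/
lemma discountedLoss_aggregate_le_add (hne : W.Nonempty) (hc : IsComplete W) (hW : Convex ℝ W)
    (hbase : ∀ t < T, base t ∈ W) (hstart : ∀ i, 1 ≤ i → i ≤ N + 1 → start i ∈ W)
    (hG0 : 0 < G) (hD0 : 0 < D) (hf : ∀ t < T, ConvexOn ℝ W (f t))
    (hb : ∀ p q : ℕ → E, (∀ t < T, p t ∈ W) → (∀ t < T, q t ∈ W) →
      ∀ t < T, |combinerBit G D f p q t| ≤ 1)
    (hadm : ∀ k ≤ N, Admissible (window (discount T (k + 1))) Z) (hlam1 : lam < 1)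
    {k m : ℕ} (hlam : discount T (k + 1) ≤ lam) (hm : k + 1 + m ≤ N + 1) :
    discountedLoss f T lam (aggregate W G D f grad T Z base start (k + 1 + m))
      ≤ discountedLoss f T lam (aggregate W G D f grad T Z base start (k + 1))
        + m * (G * D * (Z / (1 - lam))) := by
  induction m with
  | zero => simp
  | succ m ih =>
    have hp := aggregate_mem (G := G) (D := D) (Z := Z) (f := f) (grad := grad) hne hc hW hbase
      hstart (i := k + 1 + m) (by omega)
    have hq : ∀ t < T, expert W G D grad T start (k + 1 + m + 1) t ∈ W :=
      fun t _ => expert_mem hne hc hW hstart (by omega) t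
    have hle : discount T (k + 1 + m + 1) ≤ lam := by
      refine le_trans ?_ hlam
      simp only [discount, add_tsub_cancel_right]
      have : (2 : ℝ) ^ k ≤ 2 ^ (k + 1 + m) := pow_le_pow_right₀ one_le_two (by omega)
      gcongr
    have h := discountedLoss_combiner_le_left (hadm (k + 1 + m) (by omega)) hle hlam1 hG0 hD0 hf
      hp hq (hb _ _ hp hq)
    have h2 := ih (by omega)
    rw [show k + 1 + (m + 1) = k + 1 + m + 1 by ring, aggregate]
    push_cast
    linarith

lemma discountedLoss_expert_le [CompleteSpace E] (hne : W.Nonempty) (hc : IsComplete W)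
    (hW : Convex ℝ W) (hD0 : 0 < D) (hD : ∀ x ∈ W, ∀ y ∈ W, ‖x - y‖ ≤ D)
    (hf : ∀ t < T, ConvexOn ℝ W (f t))
    (hgrad : ∀ t < T, ∀ w ∈ W, HasGradientWithinAt (f t) (grad t w) W w) (hG0 : 0 < G)
    (hG : ∀ t < T, ∀ w ∈ W, ‖grad t w‖ ≤ G) {k : ℕ} (hstart : start (k + 1) ∈ W)
    (hlam0 : 0 ≤ lam) (hlam1 : lam < 1) (hk : 1 - lam ≤ 2 ^ k / T)
    (hk' : (2 : ℝ) ^ k / T ≤ 2 * (1 - lam)) {w : E} (hw : w ∈ W) :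
    discountedLoss f T lam (expert W G D grad T start (k + 1))
        - discountedLoss f T lam (fun _ => w)
      ≤ 2 * G * D / √(1 - lam) * √2 := by
  have hδ : 0 < 1 - lam := by linarith
  set r := √(1 - lam) with hr
  have hr0 : 0 < r := sqrt_pos.2 hδ
  have hr2 : r ^ 2 = 1 - lam := sq_sqrt hδ.le
  set s := √(2 ^ (k + 1) / T) with hs
  have hk2 : (2 : ℝ) ^ (k + 1) / T = 2 * (2 ^ k / T) := by rw [pow_succ]; ring
  have hs2 : s ^ 2 = 2 * (2 ^ k / T) := by rw [hs, sq_sqrt (by positivity), hk2]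
  have hsr : r ≤ s := sqrt_le_sqrt (by rw [hk2]; linarith)
  have hs0 : 0 < s := hr0.trans_le hsr
  have hsr' : s ≤ 2 * r := by
    refine le_of_sq_le_sq ?_ (by positivity)
    rw [mul_pow, hr2, hs2]; linarith
  have hη : 0 < stepSize G D T (k + 1) := mul_pos (div_pos hD0 hG0) hs0
  rw [discountedLoss_sub]
  refine (ogd_regret_le hne hc hW hD hf hgrad hG hη hstart hlam0 hlam1 hw).trans ?_
  have h1 : D ^ 2 / (2 * stepSize G D T (k + 1)) ≤ G * D / r * (1 / 2) := by
    rw [stepSize, ← hs]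
    calc D ^ 2 / (2 * (D / G * s)) = G * D / s * (1 / 2) := by field_simp
      _ ≤ _ := by gcongr
  have h2 : stepSize G D T (k + 1) * G ^ 2 / 2 / (1 - lam) ≤ G * D / r := by
    rw [stepSize, ← hs, ← hr2]
    calc D / G * s * G ^ 2 / 2 / r ^ 2 = G * D * s / (2 * r ^ 2) := by field_simp
      _ ≤ G * D * (2 * r) / (2 * r ^ 2) := by gcongr
      _ = G * D / r := by field_simp
  have h3 : (1 : ℝ) ≤ √2 := one_le_sqrt.2 one_le_two
  have h4 : 0 < G * D / r := by positivity
  have h5 : 2 * G * D / r * √2 = G * D / r * (2 * √2) := by ring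
  rw [h5]
  nlinarith

/-- The discounted regret of Smoothed OGD, simultaneously for all discount factors. -/
theorem discountedLoss_sogd_le [CompleteSpace E] (hne : W.Nonempty) (hc : IsComplete W)
    (hW : Convex ℝ W) (hD0 : 0 < D) (hD : ∀ x ∈ W, ∀ y ∈ W, ‖x - y‖ ≤ D)
    (hf : ∀ t < T, ConvexOn ℝ W (f t))
    (hgrad : ∀ t < T, ∀ w ∈ W, HasGradientWithinAt (f t) (grad t w) W w) (hG0 : 0 < G)
    (hG : ∀ t < T, ∀ w ∈ W, ‖grad t w‖ ≤ G)
    (hbase : ∀ t < T, base t ∈ W) (hstart : ∀ i, 1 ≤ i → i ≤ N + 1 → start i ∈ W)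
    (hT : 0 < T) (hlam0 : 0 ≤ lam) (hlamT : 1 / (T : ℝ) ≤ 1 - lam) (hlamN : 1 - lam ≤ 2 ^ N / T)
    (hadm : ∀ k ≤ N, Admissible (window (discount T (k + 1))) Z) {w : E} (hw : w ∈ W) :
    discountedLoss f T lam (sogd W G D f grad T N Z base start)
        - discountedLoss f T lam (fun _ => w)
      ≤ 2 * G * D / √(1 - lam) * (4 * √(log (1 / Z)) + √2)
        + G * D * (N + 1) * Z / (1 - lam) + 2 * G * D := by
  have hT' : (0 : ℝ) < T := by exact_mod_cast hT
  have hδ : 0 < 1 - lam := lt_of_lt_of_le (by positivity) hlamT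
  have hlam1 : lam < 1 := by linarith
  obtain ⟨k, hkN, hk, hk'⟩ := exists_two_pow_div_mem_Icc hT hlamT hlamN
  have hb : ∀ p q : ℕ → E, (∀ t < T, p t ∈ W) → (∀ t < T, q t ∈ W) →
      ∀ t < T, |combinerBit G D f p q t| ≤ 1 := fun p q hp hq t ht =>
    abs_combinerBit_le hG0 hD0 hD (hf t ht) (hgrad t ht) (hG t ht) (hp t ht) (hq t ht)
  have hρ : 1 - discount T (k + 1) = 2 ^ k / T := by simp [discount]
  have hle : discount T (k + 1) ≤ lam := by linarith
  have ha := hadm k hkN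
  have hZ := ha.pos
  have hp := aggregate_mem (G := G) (D := D) (Z := Z) (f := f) (grad := grad) hne hc hW hbase
    hstart (i := k) (by omega)
  have hq : ∀ t < T, expert W G D grad T start (k + 1) t ∈ W :=
    fun t _ => expert_mem hne hc hW hstart (by omega) t
  have h1 := discountedLoss_aggregate_le_add (G := G) (D := D) (f := f) (grad := grad) hne hc hW
    hbase hstart hG0 hD0 hf hb hadm hlam1 hle (m := N - k) (by omega)
  have h2 := discountedLoss_combiner_le_right ha hle hlam1 hG0 hD0 hf hp hq (hb _ _ hp hq)
  have h3 := discountedLoss_expert_le hne hc hW hD0 hD hf hgrad hG0 hG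
    (hstart (k + 1) (by omega) (by omega)) hlam0 hlam1 hk hk' hw
  rw [show k + 1 + (N - k) = N + 1 by omega, Nat.cast_sub hkN] at h1
  have hU0 := ha.threshold_pos
  -- The window of the chosen level is at most 1 / (1 - λ). The 1 in U + 1, times the ratio bound 2,
  -- becomes the final summand 2GD.
  have hU : threshold (window (discount T (k + 1))) Z ≤ 4 * √(log (1 / Z)) / √(1 - lam) := by
    refine (threshold_le ha.exp_le ha.pos ha.half_le).trans ?_
    rw [mul_div_assoc, ← sqrt_div (by linarith [ha.half_le])]
    have hw : window (discount T (k + 1)) ≤ 1 / (1 - lam) := by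
      rw [window, hρ]
      exact one_div_le_one_div_of_le hδ hk
    have hl := ha.half_le
    gcongr
    calc _ ≤ 1 / (1 - lam) * log (1 / Z) := by gcongr
      _ = _ := by ring
  have hr : (1 - discount T (k + 1)) / (1 - lam) ≤ 2 := by
    rw [hρ, div_le_iff₀ hδ]; exact hk'
  have hGD := mul_pos hG0 hD0
  have hreg : G * D * ((threshold (window (discount T (k + 1))) Z + 1)
        * ((1 - discount T (k + 1)) / (1 - lam)) + Z / (1 - lam))
      ≤ G * D * ((4 * √(log (1 / Z)) / √(1 - lam) + 1) * 2 + Z / (1 - lam)) := by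
    have : 0 ≤ (1 - discount T (k + 1)) / (1 - lam) := by rw [hρ]; positivity
    gcongr
  have hkZ : 0 ≤ (k : ℝ) * (G * D * (Z / (1 - lam))) := by positivity
  have he : 2 * G * D / √(1 - lam) * (4 * √(log (1 / Z)) + √2)
        + G * D * (N + 1) * Z / (1 - lam) + 2 * G * D
      = G * D * ((4 * √(log (1 / Z)) / √(1 - lam) + 1) * 2 + Z / (1 - lam))
        + 2 * G * D / √(1 - lam) * √2 + N * (G * D * (Z / (1 - lam))) := by ring
  rw [he, sogd]
  change discountedLoss f T lam (aggregate W G D f grad T Z base start (k + 1)) ≤ _ at h2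
  linarith

end Aggregate

/-- The regret bound of Smoothed OGD is of order `√(log T / (1 - lam))`. -/
lemma regret_bound_le {G D lam : ℝ} {T N : ℕ} (hG : 0 < G) (hD : 0 < D) (hT : exp 1 ≤ T)
    (hlam0 : 0 ≤ lam) (hlamT : 1 / (T : ℝ) ≤ 1 - lam) (hN : (2 : ℝ) ^ N ≤ 2 * T) :
    2 * G * D / √(1 - lam) * (4 * √(log T) + √2)
        + G * D * (N + 1) * (1 / (T : ℝ)) / (1 - lam) + 2 * G * D
      ≤ 18 * (G * D * √(log T / (1 - lam))) := by
  have hT0 : (0 : ℝ) < T := (exp_pos 1).trans_le hT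
  have hδ : 0 < 1 - lam := lt_of_lt_of_le (by positivity) hlamT
  have hL : 1 ≤ √(log T) := one_le_sqrt.2 ((le_log_iff_exp_le hT0).2 hT)
  have hr0 : 0 < √(1 - lam) := sqrt_pos.2 hδ
  have hr1 : √(1 - lam) ≤ 1 := sqrt_le_one.2 (by linarith)
  have hr2 : √(1 - lam) ^ 2 = 1 - lam := sq_sqrt hδ.le
  have hGD := mul_pos hG hD
  rw [sqrt_div (zero_le_one.trans (one_le_sqrt.1 hL))]
  set r := √(1 - lam)
  set L := √(log T)
  have hs2 : √2 ≤ 2 := sqrt_le_iff.2 (by norm_num)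
  -- Since (N + 1)² ≤ 4 · 2^N ≤ 8T, the left side is at most √(8 / T), and 1 / T ≤ 1 - λ.
  have hN1 : ((N : ℝ) + 1) * (1 / (T : ℝ)) ≤ 4 * r := by
    have h1 : ((N : ℝ) + 1) ^ 2 ≤ 4 * 2 ^ N := by exact_mod_cast succ_sq_le_four_mul_two_pow N
    refine le_of_sq_le_sq ?_ (by positivity)
    calc (((N : ℝ) + 1) * (1 / (T : ℝ))) ^ 2 = ((N : ℝ) + 1) ^ 2 / (T : ℝ) ^ 2 := by
          rw [mul_one_div, div_pow]
      _ ≤ (8 * T) / (T : ℝ) ^ 2 := by gcongr; linarith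
      _ = 8 * (1 / (T : ℝ)) := by field_simp
      _ ≤ (4 * r) ^ 2 := by rw [mul_pow, hr2]; linarith
  have hx : 1 ≤ L / r := (one_le_div hr0).2 (hr1.trans hL)
  have h1 : 2 * G * D / r * (4 * L + √2) ≤ 12 * (G * D * (L / r)) := by
    calc 2 * G * D / r * (4 * L + √2) ≤ 2 * G * D / r * (6 * L) := by gcongr; linarith
      _ = _ := by ring
  have h2 : G * D * (N + 1) * (1 / (T : ℝ)) / (1 - lam) ≤ 4 * (G * D * (L / r)) := by
    calc G * D * (N + 1) * (1 / (T : ℝ)) / (1 - lam)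
        = G * D * ((N + 1) * (1 / (T : ℝ))) / r ^ 2 := by rw [hr2]; ring
      _ ≤ G * D * (4 * r) / r ^ 2 := by gcongr
      _ = 4 * (G * D * (1 / r)) := by field_simp
      _ ≤ _ := by gcongr
  nlinarith

end SmoothedOGD

theorem theorem3 :
    ∃ C : ℝ, 0 < C ∧
      ∀ (d : ℕ) (W : Set (EuclideanSpace ℝ (Fin d))) (G D : ℝ) (T N : ℕ) (τ Z : ℝ)
        (f : ℕ → EuclideanSpace ℝ (Fin d) → ℝ)
        (grad : ℕ → EuclideanSpace ℝ (Fin d) → EuclideanSpace ℝ (Fin d))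
        (base start : ℕ → EuclideanSpace ℝ (Fin d)),
        -- the domain and its diameter
        W.Nonempty → IsClosed W → Convex ℝ W →
        0 < D → (∀ x ∈ W, ∀ y ∈ W, ‖x - y‖ ≤ D) →
        -- the losses are convex, with gradients bounded by `G`
        (∀ t < T, ConvexOn ℝ W (f t)) →
        (∀ t < T, ∀ w ∈ W, HasGradientWithinAt (f t) (grad t w) W w) →
        0 < G → (∀ t < T, ∀ w ∈ W, ‖grad t w‖ ≤ G) →
        -- the baseline and the first decisions of the experts are arbitrary in the domain
        (∀ t < T, base t ∈ W) → (∀ i, 1 ≤ i → i ≤ N + 1 → start i ∈ W) →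
        -- the parameters
        1 ≤ T → Z = 1 / (T : ℝ) →
        max (16 * Real.exp 1) (32 * Real.log (1 / Z)) ≤ τ →
        N = ⌈Real.logb 2 ((T : ℝ) / τ)⌉₊ →
        (∀ t < T, SmoothedOGD.sogd W G D f grad T N Z base start t ∈ W) ∧
        ∀ lam ∈ Set.Icc (1 - 1 / τ) (1 - 1 / (T : ℝ)), ∀ w ∈ W,
          SmoothedOGD.discountedLoss f T lam (SmoothedOGD.sogd W G D f grad T N Z base start)
              - SmoothedOGD.discountedLoss f T lam (fun _ => w)
            ≤ 2 * G * D / √(1 - lam) * (4 * √(Real.log (1 / Z)) + √2)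
              + G * D * (N + 1) * Z / (1 - lam) + 2 * G * D ∧
          2 * G * D / √(1 - lam) * (4 * √(Real.log (1 / Z)) + √2)
              + G * D * (N + 1) * Z / (1 - lam) + 2 * G * D
            ≤ C * (G * D * √(Real.log T / (1 - lam))) := by
  -- 18 = 12 + 4 + 2, one contribution for each summand of the bound.
  refine ⟨18, by norm_num, ?_⟩
  intro d W G D T N τ Z f grad base start hne hcl hW hD0 hD hf hgrad hG0 hG hbase hstart hT hZ hτ
    hN
  have hc : IsComplete W := hcl.isComplete
  refine ⟨SmoothedOGD.aggregate_mem hne hc hW hbase hstart le_rfl, ?_⟩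
  rintro lam ⟨hlam, hlamT⟩ w hw
  obtain ⟨hτe, hτl⟩ := max_le_iff.1 hτ
  have hT0 : (0 : ℝ) < T := by exact_mod_cast hT
  have he := Real.add_one_le_exp (1 : ℝ)
  have hτ0 : 0 < τ := by linarith
  -- A member of the interval of discount factors rules out T < τ.
  have hτT : τ ≤ T := (one_div_le_one_div hT0 hτ0).1 (by linarith)
  obtain ⟨hN1, hN2⟩ := SmoothedOGD.two_pow_ceil_logb ((one_le_div hτ0).2 hτT)
  rw [← hN] at hN1 hN2
  have hN3 : (2 : ℝ) ^ N * τ ≤ 2 * T := by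
    rwa [← mul_div_assoc, le_div_iff₀ hτ0] at hN2
  have hN4 : 1 - lam ≤ 2 ^ N / T := by
    have : 1 / τ ≤ 2 ^ N / T := by
      rw [div_le_div_iff₀ hτ0 hT0, one_mul]
      exact (div_le_iff₀ hτ0).1 hN1
    linarith
  have hτ1 : 1 / τ ≤ 1 := (div_le_one hτ0).2 (by linarith)
  have hlam0 : 0 ≤ lam := by linarith
  refine ⟨SmoothedOGD.discountedLoss_sogd_le hne hc hW hD0 hD hf hgrad hG0 hG hbase hstart hT hlam0
    (by linarith) hN4 (fun k hk =>
      SmoothedOGD.admissible_window_discount hT hZ hτe hτl hτT hN3 hk) hw, ?_⟩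
  have h1 : 1 / Z = T := by rw [hZ, one_div_one_div]
  rw [h1, hZ]
  refine SmoothedOGD.regret_bound_le hG0 hD0 (by linarith) hlam0 (by linarith) ?_
  have : (2 : ℝ) ^ N * 1 ≤ 2 ^ N * τ := by gcongr; linarith
  linarith
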